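/- Let $\Omega$ be a set of finitary operation symbols. An $\Omega$-group is a (not necessarily commutative) group $A$, written additively, with an operation $A^{n}\to A$ for every $n$-ary $\omega\in\Omega$ such that $\omega(0,\dots,0)=0$; homomorphisms preserve the group structure and all $\omega$. An ideal of $A$ is a normal subgroup $I$ with $\omega(a_1+x_1,\dots,a_n+x_n)-\omega(a_1,\dots,a_n)\in I$ for all $\omega$, $a_i\in A$, $x_i\in I$; ideals are themselves $\Omega$-groups, and $A/I$ denotes the quotient. A variety of $\Omega$-groups is the class of all $\Omega$-groups satisfying some given set of identities; it is regarded as a category with all homomorphisms as morphisms. Let $\mathcal C$ be a variety of $\Omega$-groups and $\mathcal X\subseteq\mathcal C$ a subvariety. A class $\mathcal R\subseteq\mathcal C$ is a radical class in $\mathcal C$ (in the sense of Kurosh and Amitsur) if it is closed under homomorphic images and every $A\in\mathcal C$ has an ideal $R(A)\in\mathcal R$ that contains all ideals of $A$ belonging to $\mathcal R$ and is such that $A/R(A)$ has no non-zero ideal belonging to $\mathcal R$. It is hereditary if every ideal of a member of $\mathcal R$ belongs to $\mathcal R$. The semisimple class corresponding to $\mathcal R$ consists of all $A\in\mathcal C$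 that have no non-zero ideal belonging to $\mathcal R$. **Proposition.** The full subcategory $\mathcal X$ is reflective in $\mathcal C$; let $F:\mathcal C\to\mathcal X$ be a reflection, with unit $\eta$. The following conditions are equivalent: (i) $\mathcal X$ is a semisimple class in $\mathcal C$ whose corresponding radical class is hereditary, that is, $\mathcal X$ is the semisimple class corresponding to some hereditary radical class $\mathcal R$ in $\mathcal C$; (ii) $F$ is a (regular epi)-reflective protolocalization, that is: $\eta_A:A\to F(A)$ is a regular epimorphism in $\mathcal C$ for every $A\in\mathcal C$, the category $\mathcal X$ is regular, and $F$ preserves short exact sequences (if $k$ is a kernel of $f$ and $f$ is a cokernel of $k$ in $\mathcal C$, then $F(k)$ is a kernel of $F(f)$ and $F(f)$ is a cokernel of $F(k)$ in $\mathcal X$). -/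

import Mathlib

open CategoryTheory CategoryTheory.Limits

universe u w

/-! ### Groups with multiple operators -/

/-- The structure of an `Ω`-group (group with multiple operators, in the sense of Higgins) on a not
necessarily commutative additive group `A`: every `ω : Ω` acts as an operation of finite arity
`ar ω`, and `{0}` is closed under all operations. -/
class OmegaGroup {Ω : Type w} (ar : Ω → ℕ) (A : Type u) [AddGroup A] where
  op : (ω : Ω) → (Fin (ar ω) → A) → A
  op_zero : ∀ ω : Ω, op ω (fun _ => 0) = 0

/-- Bundled `Ω`-groups. -/
structure OmegaGrp {Ω : Type w} (ar : Ω → ℕ) where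
  carrier : Type u
  [addGroup : AddGroup carrier]
  [omegaGroup : OmegaGroup ar carrier]

namespace OmegaGrp

variable {Ω : Type w} {ar : Ω → ℕ}

instance : CoeSort (OmegaGrp.{u} ar) (Type u) := ⟨OmegaGrp.carrier⟩

attribute [instance] OmegaGrp.addGroup OmegaGrp.omegaGroup

/-- The operation `ω` of the `Ω`-group `A`. -/
def op (A : OmegaGrp.{u} ar) (ω : Ω) (a : Fin (ar ω) → A) : A :=
  OmegaGroup.op (ar := ar) ω a

theorem op_zero (A : OmegaGrp.{u} ar) (ω : Ω) : A.op ω (fun _ => 0) = 0 :=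
  OmegaGroup.op_zero (ar := ar) ω

/-- Homomorphisms of `Ω`-groups. -/
@[ext]
structure Hom (A B : OmegaGrp.{u} ar) extends A →+ B where
  map_op' : ∀ (ω : Ω) (a : Fin (ar ω) → A), toFun (A.op ω a) = B.op ω (fun i => toFun (a i))

instance (A B : OmegaGrp.{u} ar) : CoeFun (Hom A B) (fun _ => A → B) := ⟨fun f => f.toFun⟩

/-- The category of `Ω`-groups and their homomorphisms. -/
instance : Category (OmegaGrp.{u} ar) where
  Hom A B := Hom A B
  id A := { AddMonoidHom.id A with map_op' := fun _ _ => rfl }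
  comp f g :=
    { g.toAddMonoidHom.comp f.toAddMonoidHom with
      map_op' := fun ω a => (congrArg g.toFun (f.map_op' ω a)).trans (g.map_op' ω _) }

/-- Zero morphisms are the homomorphisms that are constantly `0`. -/
instance : HasZeroMorphisms (OmegaGrp.{u} ar) where
  zero A B := ⟨({ (0 : A →+ B) with map_op' := fun ω _ => (B.op_zero ω).symm } : Hom A B)⟩
  comp_zero _ _ := rfl
  zero_comp _ _ _ g := Hom.ext (funext fun _ => g.toAddMonoidHom.map_zero)

/-! ### Varieties -/

/-- Terms in the variables `x₀, x₁, …` over the group operations and the operations in `Ω`. -/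
inductive Term {Ω : Type w} (ar : Ω → ℕ) : Type w
  | var (n : ℕ) : Term ar
  | zero : Term ar
  | neg (s : Term ar) : Term ar
  | add (s t : Term ar) : Term ar
  | op (ω : Ω) (s : Fin (ar ω) → Term ar) : Term ar

/-- The value of a term in `A` under an assignment of elements of `A` to the variables. -/
def Term.eval (A : OmegaGrp.{u} ar) (x : ℕ → A) : Term ar → A
  | .var n => x n
  | .zero => 0
  | .neg s => -(s.eval A x)
  | .add s t => s.eval A x + t.eval A x
  | .op ω s => A.op ω (fun i => (s i).eval A x)

/-- The class of all `Ω`-groups that satisfy every identity `s = t` with `(s, t) ∈ Φ`. -/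
def models (Φ : Set (Term ar × Term ar)) : ObjectProperty (OmegaGrp.{u} ar) :=
  fun A => ∀ p ∈ Φ, ∀ x : ℕ → A, p.1.eval A x = p.2.eval A x

/-- A variety of `Ω`-groups: a class of `Ω`-groups determined by a set of identities. -/
def IsVariety (C : ObjectProperty (OmegaGrp.{u} ar)) : Prop :=
  ∃ Φ : Set (Term ar × Term ar), C = models Φ

/-! ### Ideals -/

/-- Ideals of an `Ω`-group `A`: normal subgroups `I` such that
`ω (a₁ + x₁, …, aₙ + xₙ) - ω (a₁, …, aₙ) ∈ I` for all operations `ω`, all `aᵢ` in `A` and all `xᵢ`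
in `I`. -/
structure Ideal (A : OmegaGrp.{u} ar) extends AddSubgroup A where
  normal' : toAddSubgroup.Normal
  op_mem' : ∀ (ω : Ω) (a x : Fin (ar ω) → A), (∀ i, x i ∈ toAddSubgroup) →
    A.op ω (fun i => a i + x i) - A.op ω a ∈ toAddSubgroup

namespace Ideal

variable {A : OmegaGrp.{u} ar} (I : Ideal A)

instance : I.toAddSubgroup.Normal := I.normal'

theorem op_mem (ω : Ω) (x : Fin (ar ω) → A) (hx : ∀ i, x i ∈ I.toAddSubgroup) :
    A.op ω x ∈ I.toAddSubgroup := by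
  simpa [A.op_zero ω] using I.op_mem' ω (fun _ => 0) x hx

/-- An ideal, regarded as an `Ω`-group. -/
def obj : OmegaGrp.{u} ar where
  carrier := I.toAddSubgroup
  omegaGroup :=
    { op := fun ω x => ⟨A.op ω (fun i => (x i : A)), I.op_mem ω _ fun i => (x i).2⟩
      op_zero := fun ω => Subtype.ext (A.op_zero ω) }

theorem mk_op (ω : Ω) (a b : Fin (ar ω) → A)
    (h : ∀ i, (QuotientAddGroup.mk (a i) : A ⧸ I.toAddSubgroup) = QuotientAddGroup.mk (b i)) :
    (QuotientAddGroup.mk (A.op ω a) : A ⧸ I.toAddSubgroup) = QuotientAddGroup.mk (A.op ω b) := by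
  have h1 := I.op_mem' ω a (fun i => -a i + b i) fun i => QuotientAddGroup.eq.1 (h i)
  simp only [add_neg_cancel_left] at h1
  rw [QuotientAddGroup.eq]
  have h2 := I.normal'.conj_mem _ h1 (-(A.op ω a))
  simpa [sub_eq_add_neg, add_assoc] using h2

/-- The quotient of an `Ω`-group by an ideal. -/
noncomputable def quot : OmegaGrp.{u} ar where
  carrier := A ⧸ I.toAddSubgroup
  omegaGroup :=
    { op := fun ω x => QuotientAddGroup.mk (A.op ω (fun i => (x i).out))
      op_zero := fun ω => by
        have h := I.mk_op ω (fun _ => (0 : A ⧸ I.toAddSubgroup).out) (fun _ => 0)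
          (fun _ => QuotientAddGroup.out_eq' _)
        exact h.trans (by rw [A.op_zero ω]; rfl) }

/-- The canonical homomorphism onto the quotient. -/
def proj : A ⟶ I.quot :=
  ({ QuotientAddGroup.mk' I.toAddSubgroup with
      map_op' := fun ω a => I.mk_op ω a _ fun _ => (QuotientAddGroup.out_eq' _).symm } :
    Hom A I.quot)

/-- The ideal consists of `0` only. -/
def IsZero : Prop := I.toAddSubgroup = ⊥

end Ideal

/-! ### Kurosh–Amitsur radical theory -/

/-- `R` is a radical class in the class `C`: it is a subclass of `C` that is closed under homomorphic
images, and every `A` in `C` has an ideal `J` that belongs to `R` and contains all ideals of `A`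
that belong to `R`, such that `A ⧸ J` has no non-zero ideal that belongs to `R`. -/
structure IsRadicalClass (C R : ObjectProperty (OmegaGrp.{u} ar)) : Prop where
  le : R ≤ C
  of_surjective : ∀ {A B : OmegaGrp.{u} ar} (f : Hom A B), Function.Surjective f → R A → R B
  exists_radical : ∀ A : OmegaGrp.{u} ar, C A → ∃ J : Ideal A, R J.obj ∧
    (∀ I : Ideal A, R I.obj → I.toAddSubgroup ≤ J.toAddSubgroup) ∧
    (∀ I : Ideal J.quot, R I.obj → I.IsZero)

/-- The semisimple class of `R` in `C`: all members of `C` that have no non-zero ideal in `R`. -/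
def semisimpleClass (C R : ObjectProperty (OmegaGrp.{u} ar)) : ObjectProperty (OmegaGrp.{u} ar) :=
  fun A => C A ∧ ∀ I : Ideal A, R I.obj → I.IsZero

/-- `R` is hereditary: all ideals of members of `R` belong to `R`. -/
def IsHereditary (R : ObjectProperty (OmegaGrp.{u} ar)) : Prop :=
  ∀ A : OmegaGrp.{u} ar, R A → ∀ I : Ideal A, R I.obj

end OmegaGrp

/-! ### Protolocalizations -/

section Protolocalization

/-- A reflection is a (regular epi)-reflection if all components of its unit are regular
epimorphisms. -/
def IsRegularEpiReflection {C X : Type*} [Category C] [Category X] (i : X ⥤ C) [Reflective i] :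
    Prop :=
  ∀ A : C, IsRegularEpi ((reflectorAdjunction i).unit.app A)

variable {C : Type*} [Category C] [HasZeroMorphisms C]

/-- `0 ⟶ K ⟶ A ⟶ B ⟶ 0` is a short exact sequence: `k` is a kernel of `f` and `f` is a cokernel
of `k`. -/
def IsShortExactSeq {K A B : C} (k : K ⟶ A) (f : A ⟶ B) : Prop :=
  ∃ h : k ≫ f = 0,
    Nonempty (IsLimit (KernelFork.ofι k h)) ∧ Nonempty (IsColimit (CokernelCofork.ofπ f h))

variable {X : Type*} [Category X] [HasZeroMorphisms X]

/-- A reflection is a protolocalization if the reflective subcategory is regular and the reflector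
preserves short exact sequences. -/
structure IsProtolocalization (i : X ⥤ C) [Reflective i] : Prop where
  regular : CategoryTheory.Regular X
  map_shortExact : ∀ {K A B : C} (k : K ⟶ A) (f : A ⟶ B),
    IsShortExactSeq k f → IsShortExactSeq ((reflector i).map k) ((reflector i).map f)

end Protolocalization

/-! Write V(A) for `verbalIdeal X A`, the least ideal of A whose quotient lies in `X`. Every
reflection is A → A/V(A) up to isomorphism, so its unit is always surjective, hence a regular
epimorphism, and a variety is always a regular category. The content of the equivalence is thus the
preservation of short exact sequences.

For K → A → B short exact, the sequence K/V(K) → A/V(A) → B/V(B) is always exact at the middle and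
right terms, since V(B) is the image of V(A) (`IsVariety.exists_of_mem_verbalIdeal`). Exactness on
the left says that K ∩ V(A) ⊆ V(K).

If `X` is the semisimple class of a hereditary radical class `R`, then V(A) is the radical of A
(`IsRadicalClass.exists_eq_verbalIdeal`). Its ideal K ∩ V(A) belongs to `R` and is also an ideal of
K, so it lies in V(K).

Conversely, let `R` consist of all A in `C` with V(A) = A. If F preserves short exact sequences,
every ideal I ⊆ V(A) belongs to `R`, because F(I) → F(A) is both injective and zero
(`verbalRadicalClass_of_le_verbalIdeal`). Taking I = V(A) gives the radical; letting I be any ideal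
of some A in `R` gives heredity. -/

namespace OmegaGrp

variable {Ω : Type w} {ar : Ω → ℕ}

/-! ### Homomorphisms -/

/-- The additive homomorphism underlying a morphism of `Ω`-groups. -/
def addHom {A B : OmegaGrp.{u} ar} (f : A ⟶ B) : A →+ B := Hom.toAddMonoidHom f

@[simp]
theorem addHom_comp {A B C : OmegaGrp.{u} ar} (f : A ⟶ B) (g : B ⟶ C) (a : A) :
    addHom (f ≫ g) a = addHom g (addHom f a) := rfl

theorem addHom_op {A B : OmegaGrp.{u} ar} (f : A ⟶ B) (ω : Ω) (a : Fin (ar ω) → A) :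
    addHom f (A.op ω a) = B.op ω (fun i => addHom f (a i)) :=
  Hom.map_op' f ω a

theorem hom_ext {A B : OmegaGrp.{u} ar} {f g : A ⟶ B} (h : ∀ a, addHom f a = addHom g a) :
    f = g :=
  Hom.ext (funext h)

/-- An additive homomorphism that commutes with all operations, as a morphism. -/
def ofAddHom {A B : OmegaGrp.{u} ar} (f : A →+ B)
    (h : ∀ (ω : Ω) (a : Fin (ar ω) → A), f (A.op ω a) = B.op ω (fun i => f (a i))) : A ⟶ B :=
  ({ f with map_op' := h } : Hom A B)

@[simp]
theorem addHom_ofAddHom {A B : OmegaGrp.{u} ar} (f : A →+ B)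
    (h : ∀ (ω : Ω) (a : Fin (ar ω) → A), f (A.op ω a) = B.op ω (fun i => f (a i))) (a : A) :
    addHom (ofAddHom f h) a = f a := rfl

theorem exists_lift_of_injective {K A M : OmegaGrp.{u} ar} (k : K ⟶ A)
    (hk : Function.Injective (addHom k)) (g : M ⟶ A) (h : ∀ m, ∃ x, addHom k x = addHom g m) :
    ∃ l : M ⟶ K, l ≫ k = g := by
  choose l hl using h
  refine ⟨ofAddHom (AddMonoidHom.mk' l fun a b => hk ?_) fun ω a => hk ?_,
    hom_ext fun m => hl m⟩
  · simp [hl]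
  · simp [hl, addHom_op]

theorem exists_desc_of_surjective {A B D : OmegaGrp.{u} ar} (f : A ⟶ B)
    (hf : Function.Surjective (addHom f)) (g : A ⟶ D)
    (h : ∀ a, addHom f a = 0 → addHom g a = 0) :
    ∃ d : B ⟶ D, f ≫ d = g := by
  have key : ∀ a b, addHom f a = addHom f b → addHom g a = addHom g b := fun a b hab => by
    have := h (a - b) (by simp [hab])
    simpa [sub_eq_zero] using this
  choose s hs using hf
  refine ⟨ofAddHom (AddMonoidHom.mk' (fun b => addHom g (s b)) fun a b => ?_) fun ω a => ?_,
    hom_ext fun a => key _ _ (hs _)⟩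
  · rw [← map_add]
    exact key _ _ (by simp [hs])
  · simp only [AddMonoidHom.mk'_apply]
    rw [← addHom_op]
    exact key _ _ (by simp [hs, addHom_op])

/-! ### Ideals -/

namespace Ideal

variable {A : OmegaGrp.{u} ar}

/-- The inclusion of an ideal. -/
def incl (I : Ideal A) : I.obj ⟶ A :=
  ofAddHom (A := I.obj) I.toAddSubgroup.subtype fun _ _ => rfl

@[simp]
theorem incl_mem (I : Ideal A) (x : I.obj) : addHom I.incl x ∈ I.toAddSubgroup :=
  Subtype.property (p := (· ∈ I.toAddSubgroup)) x

theorem incl_injective (I : Ideal A) : Function.Injective (addHom I.incl) :=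
  Subtype.val_injective

theorem exists_incl_eq_iff (I : Ideal A) (a : A) :
    (∃ x, addHom I.incl x = a) ↔ a ∈ I.toAddSubgroup :=
  ⟨fun ⟨x, hx⟩ => hx ▸ I.incl_mem x, fun h => ⟨(⟨a, h⟩ : I.toAddSubgroup), rfl⟩⟩

theorem proj_surjective (I : Ideal A) : Function.Surjective (addHom I.proj) :=
  QuotientAddGroup.mk'_surjective I.toAddSubgroup

@[simp]
theorem proj_eq_zero_iff (I : Ideal A) (a : A) : addHom I.proj a = 0 ↔ a ∈ I.toAddSubgroup :=
  QuotientAddGroup.eq_zero_iff a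

theorem isZero_iff (I : Ideal A) : I.IsZero ↔ ∀ a ∈ I.toAddSubgroup, a = 0 :=
  AddSubgroup.eq_bot_iff_forall _

/-- The kernel of a homomorphism, as an ideal. -/
def ker {B : OmegaGrp.{u} ar} (f : A ⟶ B) : Ideal A where
  toAddSubgroup := (addHom f).ker
  normal' := inferInstance
  op_mem' ω a x hx := by
    simp only [AddMonoidHom.mem_ker] at hx ⊢
    simp [addHom_op, hx]

@[simp]
theorem mem_ker {B : OmegaGrp.{u} ar} (f : A ⟶ B) (a : A) :
    a ∈ (ker f).toAddSubgroup ↔ addHom f a = 0 := Iff.rfl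

/-- The image of an ideal under a surjective homomorphism. -/
def map {B : OmegaGrp.{u} ar} (f : A ⟶ B) (hf : Function.Surjective (addHom f)) (I : Ideal A) :
    Ideal B where
  toAddSubgroup := I.toAddSubgroup.map (addHom f)
  normal' := I.normal'.map _ hf
  op_mem' ω b y hy := by
    choose a ha using fun i => hf (b i)
    choose x hx hxy using hy
    refine ⟨_, I.op_mem' ω a x hx, ?_⟩
    simp only [map_sub, addHom_op, map_add, ha]
    simp only [← hxy]

@[simp]
theorem mem_map {B : OmegaGrp.{u} ar} (f : A ⟶ B) (hf : Function.Surjective (addHom f))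
    (I : Ideal A) (b : B) :
    b ∈ (I.map f hf).toAddSubgroup ↔ ∃ a ∈ I.toAddSubgroup, addHom f a = b := Iff.rfl

theorem exists_surjective_map {B : OmegaGrp.{u} ar} (f : A ⟶ B)
    (hf : Function.Surjective (addHom f)) (I : Ideal A) :
    ∃ g : I.obj ⟶ (I.map f hf).obj, Function.Surjective (addHom g) := by
  obtain ⟨g, hg⟩ := exists_lift_of_injective (I.map f hf).incl (I.map f hf).incl_injective
    (I.incl ≫ f) fun m => by
      rw [exists_incl_eq_iff, mem_map]
      exact ⟨_, I.incl_mem m, rfl⟩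
  refine ⟨g, fun y => ?_⟩
  obtain ⟨a, ha, hay⟩ := (I.map f hf).incl_mem y
  obtain ⟨x, rfl⟩ := (I.exists_incl_eq_iff a).2 ha
  refine ⟨x, (I.map f hf).incl_injective ?_⟩
  rw [← addHom_comp, hg]
  exact hay

theorem exists_quot_ker_desc {B : OmegaGrp.{u} ar} (f : A ⟶ B) :
    ∃ d : (ker f).quot ⟶ B, (ker f).proj ≫ d = f ∧ Function.Injective (addHom d) := by
  obtain ⟨d, hd⟩ := exists_desc_of_surjective (ker f).proj (ker f).proj_surjective f (by simp)
  refine ⟨d, hd, (injective_iff_map_eq_zero _).2 fun y hy => ?_⟩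
  obtain ⟨a, rfl⟩ := (ker f).proj_surjective y
  rw [← addHom_comp, hd] at hy
  simpa using hy

end Ideal

/-! ### Pullbacks and the zero object -/

/-- The pullback of two homomorphisms. -/
def pullbackObj {A B D : OmegaGrp.{u} ar} (f : A ⟶ D) (g : B ⟶ D) : OmegaGrp.{u} ar where
  carrier := ((addHom f).comp (AddMonoidHom.fst A B)).eqLocus
    ((addHom g).comp (AddMonoidHom.snd A B))
  omegaGroup :=
    { op := fun ω x => ⟨(A.op ω (fun i => (x i).1.1), B.op ω (fun i => (x i).1.2)), by
        have h : ∀ i, addHom f (x i).1.1 = addHom g (x i).1.2 := fun i => (x i).2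
        change addHom f (A.op ω _) = addHom g (B.op ω _)
        simp only [addHom_op, h]⟩
      op_zero := fun ω => Subtype.ext (Prod.ext (A.op_zero ω) (B.op_zero ω)) }

section

variable {A B D : OmegaGrp.{u} ar} (f : A ⟶ D) (g : B ⟶ D)

/-- The first projection of the pullback. -/
def pullbackFst : pullbackObj f g ⟶ A :=
  ofAddHom (A := pullbackObj f g) ((AddMonoidHom.fst A B).comp (AddSubgroup.subtype _))
    fun _ _ => rfl

/-- The second projection of the pullback. -/
def pullbackSnd : pullbackObj f g ⟶ B :=
  ofAddHom (A := pullbackObj f g) ((AddMonoidHom.snd A B).comp (AddSubgroup.subtype _))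
    fun _ _ => rfl

theorem pullback_comm : pullbackFst f g ≫ f = pullbackSnd f g ≫ g :=
  hom_ext fun a => Subtype.property (p := (· ∈ ((addHom f).comp (AddMonoidHom.fst A B)).eqLocus
    ((addHom g).comp (AddMonoidHom.snd A B)))) a

theorem pullback_point_ext {x y : pullbackObj f g}
    (h₁ : addHom (pullbackFst f g) x = addHom (pullbackFst f g) y)
    (h₂ : addHom (pullbackSnd f g) x = addHom (pullbackSnd f g) y) : x = y :=
  Subtype.ext (Prod.ext h₁ h₂)

theorem exists_pullback_point {a : A} {b : B} (h : addHom f a = addHom g b) :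
    ∃ x, addHom (pullbackFst f g) x = a ∧ addHom (pullbackSnd f g) x = b :=
  ⟨⟨(a, b), h⟩, rfl, rfl⟩

theorem exists_pullback_lift {E : OmegaGrp.{u} ar} (p : E ⟶ A) (q : E ⟶ B)
    (h : p ≫ f = q ≫ g) :
    ∃ l : E ⟶ pullbackObj f g, l ≫ pullbackFst f g = p ∧ l ≫ pullbackSnd f g = q := by
  have h' (e : E) : addHom f (addHom p e) = addHom g (addHom q e) := by
    rw [← addHom_comp, h, addHom_comp]
  choose l hl₁ hl₂ using fun e => exists_pullback_point f g (h' e)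
  refine ⟨ofAddHom (AddMonoidHom.mk' l fun a b => pullback_point_ext f g ?_ ?_) fun ω a =>
    pullback_point_ext f g ?_ ?_, hom_ext hl₁, hom_ext hl₂⟩ <;>
  simp [hl₁, hl₂, addHom_op]

end

/-- The zero `Ω`-group. -/
def zeroObj (ar : Ω → ℕ) : OmegaGrp.{u} ar where
  carrier := PUnit
  omegaGroup := { op := fun _ _ => 0, op_zero := fun _ => rfl }

/-! ### Varieties -/

theorem addHom_eval {A B : OmegaGrp.{u} ar} (f : A ⟶ B) (x : ℕ → A) (t : Term ar) :
    addHom f (t.eval A x) = t.eval B (fun n => addHom f (x n)) := by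
  induction t with
  | var n => rfl
  | zero => exact map_zero _
  | neg s hs => simp [Term.eval, hs]
  | add s t hs ht => simp [Term.eval, hs, ht]
  | op ω s hs => simp [Term.eval, addHom_op, hs]

namespace IsVariety

variable {P : ObjectProperty (OmegaGrp.{u} ar)}

/-- Identities can be tested after applying a point-separating family of homomorphisms. This
replaces closure under products and subobjects without forming a product, so the family may be
indexed by all members of `P`, or be empty. -/
theorem of_jointly_injective (hP : IsVariety P) {A : OmegaGrp.{u} ar} {ι : Sort*}
    (B : ι → OmegaGrp.{u} ar) (hB : ∀ i, P (B i)) (f : ∀ i, A ⟶ B i)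
    (hf : ∀ a b, (∀ i, addHom (f i) a = addHom (f i) b) → a = b) : P A := by
  obtain ⟨Φ, rfl⟩ := hP
  intro p hp x
  refine hf _ _ fun i => ?_
  rw [addHom_eval, addHom_eval, hB i p hp]

theorem of_injective (hP : IsVariety P) {A B : OmegaGrp.{u} ar} (f : A ⟶ B)
    (hf : Function.Injective (addHom f)) (hB : P B) : P A :=
  hP.of_jointly_injective (fun _ : Unit => B) (fun _ => hB) (fun _ => f) fun _ _ h => hf (h ())

theorem of_surjective (hP : IsVariety P) {A B : OmegaGrp.{u} ar} (f : A ⟶ B)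
    (hf : Function.Surjective (addHom f)) (hA : P A) : P B := by
  obtain ⟨Φ, rfl⟩ := hP
  intro p hp x
  choose y hy using fun n => hf (x n)
  have := congrArg (addHom f) (hA p hp y)
  simpa only [addHom_eval, hy] using this

theorem ideal (hP : IsVariety P) {A : OmegaGrp.{u} ar} (hA : P A) (I : Ideal A) : P I.obj :=
  hP.of_injective I.incl I.incl_injective hA

theorem quot (hP : IsVariety P) {A : OmegaGrp.{u} ar} (hA : P A) (I : Ideal A) : P I.quot :=
  hP.of_surjective I.proj I.proj_surjective hA

theorem pullbackObj (hP : IsVariety P) {A B D : OmegaGrp.{u} ar} (f : A ⟶ D) (g : B ⟶ D)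
    (hA : P A) (hB : P B) : P (pullbackObj f g) :=
  hP.of_jointly_injective (fun b : Bool => bif b then A else B) (fun b => by cases b <;> assumption)
    (fun b => match b with
      | true => pullbackFst f g
      | false => pullbackSnd f g)
    fun _ _ h => pullback_point_ext f g (h true) (h false)

theorem zeroObj (hP : IsVariety P) : P (zeroObj ar) :=
  hP.of_jointly_injective (fun e : Empty => e.elim) (fun e => e.elim) (fun e => e.elim)
    fun _ _ _ => rfl

end IsVariety

/-! ### The verbal ideal -/

/-- The elements of `A` that vanish under all homomorphisms to members of `P`. -/
def verbalIdeal (P : ObjectProperty (OmegaGrp.{u} ar)) (A : OmegaGrp.{u} ar) : Ideal A where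
  carrier := {a | ∀ (B : OmegaGrp.{u} ar) (_ : P B) (f : A ⟶ B), addHom f a = 0}
  add_mem' ha hb B hB f := by simp [ha B hB f, hb B hB f]
  zero_mem' B hB f := map_zero _
  neg_mem' ha B hB f := by simp [ha B hB f]
  normal' := ⟨fun a ha b B hB f => by simp [ha B hB f]⟩
  op_mem' ω a x hx B hB f := by
    have h i : addHom f (x i) = 0 := hx i B hB f
    simp [addHom_op, h]

section

variable {P : ObjectProperty (OmegaGrp.{u} ar)} {A B : OmegaGrp.{u} ar}

theorem map_mem_verbalIdeal (f : A ⟶ B) {a : A} (ha : a ∈ (verbalIdeal P A).toAddSubgroup) :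
    addHom f a ∈ (verbalIdeal P B).toAddSubgroup :=
  fun D hD g => ha D hD (f ≫ g)

/-- Homomorphisms from A to members of `P` factor through the quotient, and by the definition of the
ideal the factorizations separate its points. -/
theorem IsVariety.quot_verbalIdeal (hP : IsVariety P) (A : OmegaGrp.{u} ar) :
    P (verbalIdeal P A).quot := by
  have h (i : Σ' (B : OmegaGrp.{u} ar) (_ : P B), A ⟶ B) :=
    exists_desc_of_surjective (verbalIdeal P A).proj (verbalIdeal P A).proj_surjective i.2.2
      fun a ha => ((verbalIdeal P A).proj_eq_zero_iff a).1 ha _ i.2.1 i.2.2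
  choose d hd using h
  refine hP.of_jointly_injective _ (fun i => i.2.1) d fun x y hxy => ?_
  rw [← sub_eq_zero]
  obtain ⟨a, ha⟩ := (verbalIdeal P A).proj_surjective (x - y)
  rw [← ha, Ideal.proj_eq_zero_iff]
  intro B hB f
  have h := hd ⟨B, hB, f⟩
  dsimp only at h
  rw [← h, addHom_comp, ha, map_sub, hxy, sub_self]

theorem verbalIdeal_le (I : Ideal A) (hI : P I.quot) :
    (verbalIdeal P A).toAddSubgroup ≤ I.toAddSubgroup :=
  fun a ha => (I.proj_eq_zero_iff a).1 (ha _ hI I.proj)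

/-- If I is the image of V(A), then B/I is a homomorphic image of A/V(A), so it lies in `P` and V(B)
≤ I. -/
theorem IsVariety.exists_of_mem_verbalIdeal (hP : IsVariety P) (f : A ⟶ B)
    (hf : Function.Surjective (addHom f)) {b : B} (hb : b ∈ (verbalIdeal P B).toAddSubgroup) :
    ∃ a ∈ (verbalIdeal P A).toAddSubgroup, addHom f a = b := by
  let I := (verbalIdeal P A).map f hf
  obtain ⟨d, hd⟩ := exists_desc_of_surjective (verbalIdeal P A).proj
    (verbalIdeal P A).proj_surjective (f ≫ I.proj) fun a ha => by
      rw [addHom_comp, Ideal.proj_eq_zero_iff]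
      exact ⟨a, by simpa using ha, rfl⟩
  have hds : Function.Surjective (addHom d) := by
    have : Function.Surjective (addHom (f ≫ I.proj)) := I.proj_surjective.comp hf
    rw [← hd] at this
    exact Function.Surjective.of_comp this
  exact verbalIdeal_le I (hP.of_surjective d hds (hP.quot_verbalIdeal A)) hb

end

/-! ### Varieties as categories -/

namespace IsVariety

variable {P : ObjectProperty (OmegaGrp.{u} ar)}

section

variable {A B D : P.FullSubcategory}

/-- Being epi does not by itself give surjectivity. The factorization `d`, which regular
epimorphisms and cokernels both provide, makes the injection of A/ker f into B a split epimorphism.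
-/
theorem surjective_of_comp_eq_proj (hP : IsVariety P) (f : A ⟶ B) [Epi f]
    (d : B.obj ⟶ (Ideal.ker f.hom).quot) (hd : f.hom ≫ d = (Ideal.ker f.hom).proj) :
    Function.Surjective (addHom f.hom) := by
  obtain ⟨e, he, -⟩ := Ideal.exists_quot_ker_desc f.hom
  let d' : B ⟶ ⟨_, hP.quot A.property (Ideal.ker f.hom)⟩ := ObjectProperty.homMk d
  let e' : ⟨_, hP.quot A.property (Ideal.ker f.hom)⟩ ⟶ B := ObjectProperty.homMk e
  have h : d' ≫ e' = 𝟙 B := by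
    rw [← cancel_epi f]
    ext : 1
    simp only [d', e', ObjectProperty.FullSubcategory.comp_hom, ObjectProperty.homMk_hom,
      reassoc_of% hd, he, Category.comp_id]
  intro b
  obtain ⟨a, ha⟩ := (Ideal.ker f.hom).proj_surjective (addHom d b)
  refine ⟨a, ?_⟩
  rw [← he, addHom_comp, ha]
  exact congrArg (fun t : B ⟶ B => addHom t.hom b) h

theorem surjective_of_isRegularEpi (hP : IsVariety P) (f : A ⟶ B) [IsRegularEpi f] :
    Function.Surjective (addHom f.hom) := by
  let h := IsRegularEpi.getStruct f
  have : Epi f := h.epi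
  obtain ⟨e, he, hei⟩ := Ideal.exists_quot_ker_desc f.hom
  let q : A ⟶ ⟨_, hP.quot A.property (Ideal.ker f.hom)⟩ :=
    ObjectProperty.homMk (Ideal.ker f.hom).proj
  have hq : h.left ≫ q = h.right ≫ q := by
    ext : 1
    refine hom_ext fun a => hei ?_
    rw [← addHom_comp, ← addHom_comp]
    have := congrArg InducedCategory.Hom.hom h.w
    simpa [q, he] using congrArg (fun t => addHom t a) this
  obtain ⟨d, hd⟩ := Cofork.IsColimit.desc' h.isColimit q hq
  exact hP.surjective_of_comp_eq_proj f d.hom (congrArg InducedCategory.Hom.hom hd)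

/-- The explicit pullback in a variety. -/
def pullbackCat (hP : IsVariety P) (f : A ⟶ D) (g : B ⟶ D) : P.FullSubcategory :=
  ⟨OmegaGrp.pullbackObj f.hom g.hom, hP.pullbackObj _ _ A.property B.property⟩

theorem isPullback (hP : IsVariety P) (f : A ⟶ D) (g : B ⟶ D) :
    IsPullback (P := hP.pullbackCat f g) (ObjectProperty.homMk (pullbackFst f.hom g.hom))
      (ObjectProperty.homMk (pullbackSnd f.hom g.hom)) f g where
  w := by
    ext : 1
    exact pullback_comm f.hom g.hom
  isLimit' := by
    have h (s : PullbackCone f g) := exists_pullback_lift f.hom g.hom s.fst.hom s.snd.hom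
      (congrArg InducedCategory.Hom.hom s.condition)
    choose l hl₁ hl₂ using h
    refine ⟨PullbackCone.IsLimit.mk _ (fun s => ObjectProperty.homMk (l s)) (fun s => ?_)
      (fun s => ?_) fun s m h₁ h₂ => ?_⟩
    · ext : 1
      exact hl₁ s
    · ext : 1
      exact hl₂ s
    · ext : 1
      refine hom_ext fun a => pullback_point_ext f.hom g.hom ?_ ?_
      · exact congrArg (fun t => addHom t a)
          ((congrArg InducedCategory.Hom.hom h₁).trans (hl₁ s).symm)
      · exact congrArg (fun t => addHom t a)
          ((congrArg InducedCategory.Hom.hom h₂).trans (hl₂ s).symm)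

theorem exists_point_of_isPullback (hP : IsVariety P) {E : P.FullSubcategory} {p : E ⟶ A}
    {q : E ⟶ B} {f : A ⟶ D} {g : B ⟶ D} (h : IsPullback p q f g) {a : A.obj} {b : B.obj}
    (hab : addHom f.hom a = addHom g.hom b) :
    ∃ e, addHom p.hom e = a ∧ addHom q.hom e = b := by
  obtain ⟨x, rfl, rfl⟩ := exists_pullback_point f.hom g.hom hab
  -- The comparison map from the explicit pullback carries its points to the given one.
  refine ⟨addHom (h.lift _ _ (hP.isPullback f g).w).hom x, ?_, ?_⟩
  · exact congrArg (fun t : hP.pullbackCat f g ⟶ A => addHom t.hom x)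
      (h.lift_fst _ _ (hP.isPullback f g).w)
  · exact congrArg (fun t : hP.pullbackCat f g ⟶ B => addHom t.hom x)
      (h.lift_snd _ _ (hP.isPullback f g).w)

theorem hasFiniteLimits (hP : IsVariety P) : HasFiniteLimits P.FullSubcategory := by
  have h : ∀ {A B D : P.FullSubcategory} {f : A ⟶ D} {g : B ⟶ D}, HasLimit (cospan f g) :=
    (hP.isPullback _ _).hasPullback
  have : HasPullbacks P.FullSubcategory := hasPullbacks_of_hasLimit_cospan _
  have : HasTerminal P.FullSubcategory := by
    refine IsTerminal.hasTerminal (X := ⟨OmegaGrp.zeroObj ar, hP.zeroObj⟩)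
      (IsTerminal.ofUniqueHom (fun _ => 0) fun _ _ => ?_)
    ext : 1
    exact hom_ext fun _ => rfl
  exact hasFiniteLimits_of_hasTerminal_and_pullbacks

theorem epi_of_surjective (f : A ⟶ B) (hf : Function.Surjective (addHom f.hom)) : Epi f where
  left_cancellation u v h := by
    ext : 1
    refine hom_ext fun b => ?_
    obtain ⟨a, rfl⟩ := hf b
    exact congrArg (fun t => addHom (InducedCategory.Hom.hom t) a) h

/-- A surjective homomorphism is a coequalizer of any two homomorphisms that jointly cover its
kernel pair. -/
theorem nonempty_isColimit_cofork {E : P.FullSubcategory} (l r : E ⟶ A) (f : A ⟶ B)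
    (w : l ≫ f = r ≫ f) (hf : Function.Surjective (addHom f.hom))
    (h : ∀ a, addHom f.hom a = 0 → ∃ e, addHom l.hom e = a ∧ addHom r.hom e = 0) :
    Nonempty (IsColimit (Cofork.ofπ f w)) := by
  have := epi_of_surjective f hf
  have key (s : Cofork l r) : ∃ d, f.hom ≫ d = s.π.hom := by
    refine exists_desc_of_surjective f.hom hf s.π.hom fun a ha => ?_
    obtain ⟨e, rfl, he⟩ := h a ha
    have := congrArg (fun t => addHom (InducedCategory.Hom.hom t) e) s.condition
    simpa [he] using this
  choose d hd using key
  refine ⟨Cofork.IsColimit.mk _ (fun s => ObjectProperty.homMk (d s)) (fun s => ?_)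
    fun s m hm => ?_⟩
  · ext : 1
    exact hd s
  · rw [← cancel_epi f]
    ext : 1
    exact (congrArg InducedCategory.Hom.hom hm).trans (hd s).symm

theorem isRegularEpi_of_surjective (hP : IsVariety P) (f : A ⟶ B)
    (hf : Function.Surjective (addHom f.hom)) : IsRegularEpi f := by
  obtain ⟨h⟩ := nonempty_isColimit_cofork _ _ f (hP.isPullback f f).w hf fun a ha =>
    hP.exists_point_of_isPullback (hP.isPullback f f) (b := 0) (ha.trans (map_zero _).symm)
  exact isRegularEpi_of_regularEpi ⟨_, _, _, _, h⟩

end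

/-- The coequalizer of a kernel pair is the quotient by the kernel. Regular epimorphisms are exactly
the surjections, which are stable under pullback. -/
theorem regular (hP : IsVariety P) : Regular P.FullSubcategory where
  toHasFiniteLimits := hP.hasFiniteLimits
  hasCoequalizer_of_isKernelPair {A B E f l r} h := by
    obtain ⟨e, he, hei⟩ := Ideal.exists_quot_ker_desc f.hom
    let q : A ⟶ ⟨_, hP.quot A.property (Ideal.ker f.hom)⟩ :=
      ObjectProperty.homMk (Ideal.ker f.hom).proj
    have w : l ≫ q = r ≫ q := by
      ext : 1
      refine hom_ext fun a => hei ?_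
      rw [← addHom_comp, ← addHom_comp]
      have := congrArg InducedCategory.Hom.hom h.w
      simpa [q, he] using congrArg (fun t => addHom t a) this
    obtain ⟨hc⟩ := nonempty_isColimit_cofork l r q w (Ideal.ker f.hom).proj_surjective
      fun a ha => hP.exists_point_of_isPullback h (b := 0) (by simpa [q] using ha)
    exact ⟨⟨⟨_, hc⟩⟩⟩
  regularEpiIsStableUnderBaseChange :=
    { of_isPullback := fun {A B E D f g f' g'} h hg => by
        have : IsRegularEpi g := hg
        refine hP.isRegularEpi_of_surjective _ fun b => ?_
        obtain ⟨a, ha⟩ := hP.surjective_of_isRegularEpi g (addHom f.hom b)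
        obtain ⟨e, -, he⟩ := hP.exists_point_of_isPullback h ha
        exact ⟨e, he⟩ }

/-! ### Short exact sequences -/

section

variable {K A B : P.FullSubcategory} (k : K ⟶ A) (f : A ⟶ B)

theorem isShortExactSeq_of_exact (hk : Function.Injective (addHom k.hom))
    (hf : Function.Surjective (addHom f.hom))
    (h : ∀ a, addHom f.hom a = 0 ↔ ∃ x, addHom k.hom x = a) : IsShortExactSeq k f := by
  have w : k ≫ f = 0 := by
    ext : 1
    exact hom_ext fun x => (h _).2 ⟨x, rfl⟩
  refine ⟨w, ?_, ?_⟩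
  · have key (s : KernelFork f) : ∃ l, l ≫ k.hom = s.ι.hom :=
      exists_lift_of_injective k.hom hk s.ι.hom fun m => (h _).1
        (congrArg (fun t => addHom (InducedCategory.Hom.hom t) m) s.condition)
    choose l hl using key
    refine ⟨Fork.IsLimit.mk _ (fun s => ObjectProperty.homMk (l s)) (fun s => ?_)
      fun s m hm => ?_⟩
    · ext : 1
      exact hl s
    · ext : 1
      refine hom_ext fun a => hk ?_
      exact congrArg (fun t => addHom t a)
          ((congrArg InducedCategory.Hom.hom hm).trans (hl s).symm)
  · exact nonempty_isColimit_cofork k 0 f _ hf fun a ha => by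
      obtain ⟨x, hx⟩ := (h a).1 ha
      exact ⟨x, hx, rfl⟩

variable {k f}

/-- The abstract kernel and cokernel are compared with the ideal `Ideal.ker f.hom` and its quotient,
both of which stay in the variety. -/
theorem exact_of_isShortExactSeq (hP : IsVariety P) (h : IsShortExactSeq k f) :
    Function.Injective (addHom k.hom) ∧ Function.Surjective (addHom f.hom) ∧
      ∀ a, addHom f.hom a = 0 ↔ ∃ x, addHom k.hom x = a := by
  obtain ⟨w, ⟨hk⟩, ⟨hf⟩⟩ := h
  have w' (x) : addHom f.hom (addHom k.hom x) = 0 :=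
    congrArg (fun t => addHom (InducedCategory.Hom.hom t) x) w
  let I := Ideal.ker f.hom
  let i : ⟨I.obj, hP.ideal A.property I⟩ ⟶ A := ObjectProperty.homMk I.incl
  let q : A ⟶ ⟨I.quot, hP.quot A.property I⟩ := ObjectProperty.homMk I.proj
  have hi : i ≫ f = 0 := by
    ext : 1
    exact hom_ext fun x => I.incl_mem x
  have hq : k ≫ q = 0 := by
    ext : 1
    exact hom_ext fun x => (I.proj_eq_zero_iff _).2 (w' x)
  obtain ⟨l, hl⟩ := KernelFork.IsLimit.lift' hk i hi
  obtain ⟨d, hd⟩ := CokernelCofork.IsColimit.desc' hf q hq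
  have hl' (x) : addHom k.hom (addHom l.hom x) = addHom I.incl x :=
    congrArg (fun t => addHom (InducedCategory.Hom.hom t) x) hl
  have hlk (a) (ha : addHom f.hom a = 0) : ∃ x, addHom k.hom (addHom l.hom x) = a := by
    obtain ⟨x, hx⟩ := (I.exists_incl_eq_iff a).2 ha
    exact ⟨x, (hl' x).trans hx⟩
  refine ⟨?_, ?_, fun a => ⟨fun ha => ?_, ?_⟩⟩
  · obtain ⟨j, hj⟩ := exists_lift_of_injective I.incl I.incl_injective k.hom fun x =>
      (I.exists_incl_eq_iff _).2 (w' x)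
    let j' : K ⟶ ⟨I.obj, hP.ideal A.property I⟩ := ObjectProperty.homMk j
    -- The universal property makes `k` monic only in the categorical sense; this retraction turns
    -- that into injectivity on elements.
    have hjl : j' ≫ l = 𝟙 K := by
      refine Fork.IsLimit.hom_ext hk ?_
      change (j' ≫ l) ≫ k = 𝟙 K ≫ k
      ext : 1
      refine hom_ext fun x => ?_
      simpa [j', hl'] using congrArg (fun t => addHom t x) hj
    refine (injective_iff_map_eq_zero _).2 fun x hx => ?_
    have h₁ : addHom l.hom (addHom j x) = x :=
      congrArg (fun t => addHom (InducedCategory.Hom.hom t) x) hjl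
    rw [← h₁, show addHom j x = 0 from I.incl_injective ?_, map_zero]
    rw [← addHom_comp, hj, hx, map_zero]
  · have : Epi f := ⟨fun u v h => Cofork.IsColimit.hom_ext hf h⟩
    exact hP.surjective_of_comp_eq_proj f d.hom (congrArg InducedCategory.Hom.hom hd)
  · obtain ⟨x, hx⟩ := hlk a ha
    exact ⟨_, hx⟩
  · rintro ⟨x, rfl⟩
    exact w' x

end

end IsVariety

variable {C X : ObjectProperty (OmegaGrp.{u} ar)}

/-! ### Reflections -/

theorem IsVariety.nonempty_reflective (hX : IsVariety X) (hXC : X ≤ C) :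
    Nonempty (Reflective (ObjectProperty.ιOfLE hXC)) := by
  let q (A : C.FullSubcategory) := (verbalIdeal X A.obj).proj
  have hq (A : C.FullSubcategory) : Function.Surjective (addHom (q A)) := Ideal.proj_surjective _
  have key (A : C.FullSubcategory) (B : X.FullSubcategory) (g : A.obj ⟶ B.obj) :
      ∃ d, q A ≫ d = g :=
    exists_desc_of_surjective _ (hq A) _ fun a ha =>
      (Ideal.proj_eq_zero_iff _ a).1 ha _ B.property g
  choose d hd using key
  let e (A : C.FullSubcategory) (B : X.FullSubcategory) :
      ((⟨_, hX.quot_verbalIdeal A.obj⟩ : X.FullSubcategory) ⟶ B) ≃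
        (A ⟶ (ObjectProperty.ιOfLE hXC).obj B) :=
    { toFun := fun g => ObjectProperty.homMk (q A ≫ g.hom)
      invFun := fun g => ObjectProperty.homMk (d A B g.hom)
      left_inv := fun g => by
        ext : 1
        refine hom_ext fun y => ?_
        obtain ⟨a, rfl⟩ := hq A y
        exact congrArg (fun t => addHom t a) (hd A B (q A ≫ g.hom))
      right_inv := fun g => by
        ext : 1
        exact hd A B g.hom }
  have he : ∀ A B B' g h, e A B' (h ≫ g) = e A B h ≫ (ObjectProperty.ιOfLE hXC).map g :=
    fun _ _ _ _ _ => rfl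
  exact ⟨{ L := _, adj := Adjunction.adjunctionOfEquivLeft e he }⟩

section

variable (hXC : X ≤ C) [Reflective (ObjectProperty.ιOfLE hXC)]

/-- The unit of the reflection, as a homomorphism of `Ω`-groups. -/
def reflectionUnit (A : C.FullSubcategory) :
    A.obj ⟶ ((reflector (ObjectProperty.ιOfLE hXC)).obj A).obj :=
  ((reflectorAdjunction (ObjectProperty.ιOfLE hXC)).unit.app A).hom

theorem map_reflectionUnit {A B : C.FullSubcategory} (f : A ⟶ B) (a : A.obj) :
    addHom ((reflector (ObjectProperty.ιOfLE hXC)).map f).hom (addHom (reflectionUnit hXC A) a) =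
      addHom (reflectionUnit hXC B) (addHom f.hom a) :=
  (congrArg (fun t => addHom (InducedCategory.Hom.hom t) a)
    ((reflectorAdjunction (ObjectProperty.ιOfLE hXC)).unit.naturality f)).symm

theorem exists_desc_reflectionUnit (A : C.FullSubcategory) (B : X.FullSubcategory)
    (f : A.obj ⟶ B.obj) :
    ∃ d : (reflector (ObjectProperty.ιOfLE hXC)).obj A ⟶ B, reflectionUnit hXC A ≫ d.hom = f := by
  let adj := reflectorAdjunction (ObjectProperty.ιOfLE hXC)
  let f' : A ⟶ (ObjectProperty.ιOfLE hXC).obj B := ObjectProperty.homMk f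
  refine ⟨(adj.homEquiv A B).symm f', ?_⟩
  have h := (adj.homEquiv A B).apply_symm_apply f'
  rw [Adjunction.homEquiv_unit] at h
  exact congrArg InducedCategory.Hom.hom h

theorem reflectionUnit_hom_ext {A : C.FullSubcategory} {B : X.FullSubcategory}
    {f g : (reflector (ObjectProperty.ιOfLE hXC)).obj A ⟶ B}
    (h : reflectionUnit hXC A ≫ f.hom = reflectionUnit hXC A ≫ g.hom) : f = g := by
  apply ((reflectorAdjunction (ObjectProperty.ιOfLE hXC)).homEquiv A B).injective
  rw [Adjunction.homEquiv_unit, Adjunction.homEquiv_unit]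
  ext : 1
  exact h

/-- The unit lands in `X`, so it kills V(A); conversely the projection onto A/V(A) factors through
the unit. -/
theorem reflectionUnit_eq_zero_iff (hX : IsVariety X) (A : C.FullSubcategory) (a : A.obj) :
    addHom (reflectionUnit hXC A) a = 0 ↔ a ∈ (verbalIdeal X A.obj).toAddSubgroup := by
  refine ⟨fun ha => ?_, fun ha => ha _ (ObjectProperty.FullSubcategory.property _) _⟩
  obtain ⟨d, hd⟩ := exists_desc_reflectionUnit hXC A ⟨_, hX.quot_verbalIdeal A.obj⟩
    (verbalIdeal X A.obj).proj
  rw [← Ideal.proj_eq_zero_iff, ← hd, addHom_comp, ha, map_zero]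

theorem reflectionUnit_surjective (hX : IsVariety X) (A : C.FullSubcategory) :
    Function.Surjective (addHom (reflectionUnit hXC A)) := by
  obtain ⟨d, hd⟩ := exists_desc_reflectionUnit hXC A ⟨_, hX.quot_verbalIdeal A.obj⟩
    (verbalIdeal X A.obj).proj
  obtain ⟨d', hd'⟩ := exists_desc_of_surjective (verbalIdeal X A.obj).proj
    (Ideal.proj_surjective _) (reflectionUnit hXC A) fun a ha => by
      rwa [reflectionUnit_eq_zero_iff hXC hX, ← Ideal.proj_eq_zero_iff]
  -- By uniqueness of factorizations through the unit, the reflection is a retract of A/V(A), so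
  -- `d'` is surjective.
  have h : d ≫ ObjectProperty.homMk d' = 𝟙 _ := by
    apply reflectionUnit_hom_ext hXC
    simp only [ObjectProperty.FullSubcategory.comp_hom, ObjectProperty.homMk_hom,
      reassoc_of% hd, hd']
    rfl
  intro y
  obtain ⟨a, ha⟩ := (verbalIdeal X A.obj).proj_surjective (addHom d.hom y)
  refine ⟨a, ?_⟩
  rw [← hd', addHom_comp, ha]
  exact congrArg (fun t => addHom (InducedCategory.Hom.hom t) y) h

theorem isRegularEpiReflection (hC : IsVariety C) (hX : IsVariety X) :
    IsRegularEpiReflection (ObjectProperty.ιOfLE hXC) :=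
  fun A => hC.isRegularEpi_of_surjective _ (reflectionUnit_surjective hXC hX A)

end

/-! ### Hereditary radicals and protolocalizations -/

section

variable {R : ObjectProperty (OmegaGrp.{u} ar)}

/-- The image of I in A/V(A) is an ideal belonging to `R`, while A/V(A) is semisimple; so the image
is zero. -/
theorem IsRadicalClass.le_verbalIdeal (hR : IsRadicalClass C R) (hX : IsVariety X)
    (hXR : X = semisimpleClass C R) {A : OmegaGrp.{u} ar} (I : Ideal A) (hI : R I.obj) :
    I.toAddSubgroup ≤ (verbalIdeal X A).toAddSubgroup := by
  intro a ha
  obtain ⟨g, hg⟩ := I.exists_surjective_map (verbalIdeal X A).proj (Ideal.proj_surjective _)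
  have hq := hX.quot_verbalIdeal A
  -- `X` also occurs inside the ideal; abstracting the ideal confines the rewriting by `hXR` to the
  -- membership of the quotient.
  generalize verbalIdeal X A = V at *
  rw [hXR] at hq
  have := hq.2 _ (hR.of_surjective g hg hI)
  rw [← Ideal.proj_eq_zero_iff]
  exact (Ideal.isZero_iff _).1 this _ ⟨a, ha, rfl⟩

/-- The quotient by the radical is semisimple, hence in `X`, so minimality of V(A) gives the
inclusion opposite to `le_verbalIdeal`. -/
theorem IsRadicalClass.exists_eq_verbalIdeal (hR : IsRadicalClass C R) (hC : IsVariety C)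
    (hX : IsVariety X) (hXR : X = semisimpleClass C R) {A : OmegaGrp.{u} ar} (hA : C A) :
    ∃ J : Ideal A, R J.obj ∧ J.toAddSubgroup = (verbalIdeal X A).toAddSubgroup := by
  obtain ⟨J, hJ, -, hJq⟩ := hR.exists_radical A hA
  refine ⟨J, hJ, le_antisymm (hR.le_verbalIdeal hX hXR J hJ) (verbalIdeal_le J ?_)⟩
  rw [hXR]
  exact ⟨hC.quot hA J, hJq⟩

/-- For a hereditary radical, the radical of an ideal contains its intersection with the radical of
the whole `Ω`-group. -/
theorem IsRadicalClass.mem_verbalIdeal_of_map_mem (hR : IsRadicalClass C R) (hC : IsVariety C)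
    (hX : IsVariety X) (hXR : X = semisimpleClass C R) (hher : IsHereditary R)
    {K A B : OmegaGrp.{u} ar} (hA : C A) (k : K ⟶ A) (f : A ⟶ B)
    (hk : Function.Injective (addHom k))
    (h : ∀ a, addHom f a = 0 ↔ ∃ x, addHom k x = a) {x : K}
    (hx : addHom k x ∈ (verbalIdeal X A).toAddSubgroup) :
    x ∈ (verbalIdeal X K).toAddSubgroup := by
  obtain ⟨J, hJ, hJV⟩ := hR.exists_eq_verbalIdeal hC hX hXR hA
  -- `M` and `N` are both K ∩ J, the first as an ideal of J, where heredity applies, the second as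
  -- an ideal of K. The surjection `g` transports membership in `R` from `M` to `N`.
  let M := Ideal.ker (J.incl ≫ f)
  let N := Ideal.ker (k ≫ J.proj)
  have hNk : Function.Injective (addHom (N.incl ≫ k)) := hk.comp N.incl_injective
  have hMA : Function.Injective (addHom (M.incl ≫ J.incl)) :=
    J.incl_injective.comp M.incl_injective
  have hM (a : A) (h₁ : a ∈ J.toAddSubgroup) (h₂ : addHom f a = 0) :
      ∃ m, addHom (M.incl ≫ J.incl) m = a := by
    obtain ⟨y, rfl⟩ := (J.exists_incl_eq_iff a).2 h₁
    obtain ⟨m, rfl⟩ := (M.exists_incl_eq_iff y).2 h₂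
    exact ⟨m, rfl⟩
  have hN (y : K) (hy : addHom k y ∈ J.toAddSubgroup) : ∃ n, addHom N.incl n = y :=
    (N.exists_incl_eq_iff y).2 ((J.proj_eq_zero_iff _).2 hy)
  obtain ⟨g, hg⟩ := exists_lift_of_injective (N.incl ≫ k) hNk (M.incl ≫ J.incl) fun m => by
    obtain ⟨y, hy⟩ := (h (addHom (M.incl ≫ J.incl) m)).1 (M.incl_mem m)
    obtain ⟨n, rfl⟩ := hN y (hy ▸ J.incl_mem _)
    exact ⟨n, hy⟩
  have hgs : Function.Surjective (addHom g) := fun n => by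
    obtain ⟨m, hm⟩ := hM (addHom (N.incl ≫ k) n) ((J.proj_eq_zero_iff _).1 (N.incl_mem n))
      ((h _).2 ⟨_, rfl⟩)
    refine ⟨m, hNk ?_⟩
    rw [← hm, ← hg, addHom_comp g]
  refine hR.le_verbalIdeal hX hXR N (hR.of_surjective g hgs (hher _ hJ M)) ?_
  exact (J.proj_eq_zero_iff _).2 (hJV ▸ hx)

end

theorem isProtolocalization_of_isHereditary {R : ObjectProperty (OmegaGrp.{u} ar)}
    (hC : IsVariety C) (hX : IsVariety X) (hXC : X ≤ C)
    [Reflective (ObjectProperty.ιOfLE hXC)] (hR : IsRadicalClass C R)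
    (hXR : X = semisimpleClass C R) (hher : IsHereditary R) :
    IsProtolocalization (ObjectProperty.ιOfLE hXC) where
  regular := hX.regular
  map_shortExact {K A B} k f hkf := by
    obtain ⟨hk, hf, hex⟩ := hC.exact_of_isShortExactSeq hkf
    refine IsVariety.isShortExactSeq_of_exact _ _ ?_ ?_ fun y => ⟨fun hy => ?_, ?_⟩
    -- Injectivity is the only part that uses the radical class and its heredity.
    · refine (injective_iff_map_eq_zero _).2 fun y hy => ?_
      obtain ⟨x, rfl⟩ := reflectionUnit_surjective hXC hX K y
      rw [map_reflectionUnit, reflectionUnit_eq_zero_iff hXC hX] at hy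
      rw [reflectionUnit_eq_zero_iff hXC hX]
      exact hR.mem_verbalIdeal_of_map_mem hC hX hXR hher A.property k.hom f.hom hk hex hy
    · intro y
      obtain ⟨b, rfl⟩ := reflectionUnit_surjective hXC hX B y
      obtain ⟨a, rfl⟩ := hf b
      exact ⟨_, map_reflectionUnit hXC f a⟩
    · obtain ⟨a, rfl⟩ := reflectionUnit_surjective hXC hX A y
      rw [map_reflectionUnit, reflectionUnit_eq_zero_iff hXC hX] at hy
      -- Correcting `a` by an element of V(A) leaves its class in the reflection unchanged and moves
      -- it into the kernel of `f`.
      obtain ⟨v, hv, hva⟩ := hX.exists_of_mem_verbalIdeal f.hom hf hy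
      obtain ⟨x, hx⟩ := (hex (a - v)).1 (by rw [map_sub, hva, sub_self])
      refine ⟨addHom (reflectionUnit hXC K) x, ?_⟩
      rw [map_reflectionUnit, hx, map_sub, (reflectionUnit_eq_zero_iff hXC hX A v).2 hv, sub_zero]
    · rintro ⟨z, rfl⟩
      obtain ⟨x, rfl⟩ := reflectionUnit_surjective hXC hX K z
      rw [map_reflectionUnit, map_reflectionUnit, (hex _).2 ⟨x, rfl⟩, map_zero]

/-! ### The hereditary radical class of a protolocalization -/

theorem IsVariety.isShortExactSeq_ideal (hC : IsVariety C) (A : C.FullSubcategory)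
    (I : Ideal A.obj) :
    IsShortExactSeq (K := ⟨_, hC.ideal A.property I⟩) (B := ⟨_, hC.quot A.property I⟩)
      (ObjectProperty.homMk I.incl) (ObjectProperty.homMk I.proj) :=
  isShortExactSeq_of_exact _ _ I.incl_injective I.proj_surjective fun a =>
    (I.proj_eq_zero_iff a).trans (I.exists_incl_eq_iff a).symm

/-- The members of `C` all of whose homomorphisms to members of `X` are zero. -/
def verbalRadicalClass (C X : ObjectProperty (OmegaGrp.{u} ar)) :
    ObjectProperty (OmegaGrp.{u} ar) :=
  fun A => C A ∧ ∀ a, a ∈ (verbalIdeal X A).toAddSubgroup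

theorem isZero_of_verbalRadicalClass {A : OmegaGrp.{u} ar} (hA : X A) (I : Ideal A)
    (hI : verbalRadicalClass C X I.obj) : I.IsZero := by
  rw [Ideal.isZero_iff]
  intro a ha
  obtain ⟨x, rfl⟩ := (I.exists_incl_eq_iff a).2 ha
  exact hI.2 x A hA I.incl

/-- The reflector applied to I → A → A/I gives an injection F(I) → F(A). It is zero since I ≤ V(A),
so the unit of I vanishes, which means V(I) = I. -/
theorem verbalRadicalClass_of_le_verbalIdeal (hC : IsVariety C) (hX : IsVariety X) (hXC : X ≤ C)
    [Reflective (ObjectProperty.ιOfLE hXC)] (h : IsProtolocalization (ObjectProperty.ιOfLE hXC))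
    {A : OmegaGrp.{u} ar} (hA : C A) (I : Ideal A)
    (hI : I.toAddSubgroup ≤ (verbalIdeal X A).toAddSubgroup) :
    verbalRadicalClass C X I.obj := by
  refine ⟨hC.ideal hA I, fun x => ?_⟩
  have hinj := (hX.exact_of_isShortExactSeq
    (h.map_shortExact _ _ (hC.isShortExactSeq_ideal ⟨A, hA⟩ I))).1
  rw [← reflectionUnit_eq_zero_iff hXC hX ⟨I.obj, hC.ideal hA I⟩]
  apply hinj
  rw [map_reflectionUnit, map_zero, reflectionUnit_eq_zero_iff hXC hX]
  exact hI (I.incl_mem x)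

theorem isRadicalClass_verbalRadicalClass (hC : IsVariety C) (hX : IsVariety X) (hXC : X ≤ C)
    [Reflective (ObjectProperty.ιOfLE hXC)] (h : IsProtolocalization (ObjectProperty.ιOfLE hXC)) :
    IsRadicalClass C (verbalRadicalClass C X) where
  le A hA := hA.1
  of_surjective f hf hA := ⟨hC.of_surjective f hf hA.1, fun b => by
    obtain ⟨a, rfl⟩ := hf b
    exact map_mem_verbalIdeal f (hA.2 a)⟩
  exists_radical A hA := by
    refine ⟨verbalIdeal X A, verbalRadicalClass_of_le_verbalIdeal hC hX hXC h hA _ le_rfl,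
      fun I hI a ha => ?_, fun I hI => isZero_of_verbalRadicalClass (hX.quot_verbalIdeal A) I hI⟩
    obtain ⟨x, rfl⟩ := (I.exists_incl_eq_iff a).2 ha
    exact map_mem_verbalIdeal I.incl (hI.2 x)

theorem eq_semisimpleClass_verbalRadicalClass (hC : IsVariety C) (hX : IsVariety X) (hXC : X ≤ C)
    [Reflective (ObjectProperty.ιOfLE hXC)] (h : IsProtolocalization (ObjectProperty.ιOfLE hXC)) :
    X = semisimpleClass C (verbalRadicalClass C X) := by
  refine le_antisymm (fun A hA => ⟨hXC A hA, isZero_of_verbalRadicalClass hA⟩) fun A hA => ?_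
  -- V(A) itself belongs to the radical class, so it is zero in a semisimple A, and A embeds in
  -- A/V(A).
  have hV := hA.2 _ (verbalRadicalClass_of_le_verbalIdeal hC hX hXC h hA.1 _ le_rfl)
  refine hX.of_injective (verbalIdeal X A).proj ?_ (hX.quot_verbalIdeal A)
  refine (injective_iff_map_eq_zero _).2 fun a ha => ?_
  exact (Ideal.isZero_iff _).1 hV a ((Ideal.proj_eq_zero_iff _ a).1 ha)

theorem isHereditary_verbalRadicalClass (hC : IsVariety C) (hX : IsVariety X) (hXC : X ≤ C)
    [Reflective (ObjectProperty.ιOfLE hXC)] (h : IsProtolocalization (ObjectProperty.ιOfLE hXC)) :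
    IsHereditary (verbalRadicalClass C X) :=
  fun _ hA I => verbalRadicalClass_of_le_verbalIdeal hC hX hXC h hA.1 I fun a _ => hA.2 a

end OmegaGrp

theorem proposition4p6 {Ω : Type w} (ar : Ω → ℕ) (C X : ObjectProperty (OmegaGrp.{u} ar))
    (hC : OmegaGrp.IsVariety C) (hX : OmegaGrp.IsVariety X) (hXC : X ≤ C) :
    Nonempty (Reflective (ObjectProperty.ιOfLE hXC)) ∧
    ∀ [Reflective (ObjectProperty.ιOfLE hXC)],
      ((∃ R : ObjectProperty (OmegaGrp.{u} ar), OmegaGrp.IsRadicalClass C R ∧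
          X = OmegaGrp.semisimpleClass C R ∧ OmegaGrp.IsHereditary R) ↔
        IsRegularEpiReflection (ObjectProperty.ιOfLE hXC) ∧
          IsProtolocalization (ObjectProperty.ιOfLE hXC)) := by
  refine ⟨hX.nonempty_reflective hXC, ⟨?_, ?_⟩⟩
  · rintro ⟨R, hR, hXR, hher⟩
    exact ⟨OmegaGrp.isRegularEpiReflection hXC hC hX,
      OmegaGrp.isProtolocalization_of_isHereditary hC hX hXC hR hXR hher⟩
  · rintro ⟨-, h⟩
    exact ⟨_, OmegaGrp.isRadicalClass_verbalRadicalClass hC hX hXC h,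
      OmegaGrp.eq_semisimpleClass_verbalRadicalClass hC hX hXC h,
      OmegaGrp.isHereditary_verbalRadicalClass hC hX hXC h⟩
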